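/- Let $U\subset\mathbb{R}^n$ be an open convex set, let $f\colon U\to\mathbb{R}$ be convex, and let $(x_k)_{k\ge 0}$ be a sequence in $U$ that is a BFGS sequence for $f$. This means: $f$ is differentiable at each $x_k$ with $\nabla f(x_k)\neq 0$, and there exist parameters $0<\mu<\nu<1$ and a positive definite $n\times n$ matrix $H_0$ such that the vectors $s_k=x_{k+1}-x_k$, $y_k=\nabla f(x_{k+1})-\nabla f(x_k)$ and the matrices defined recursively by $$V_k=I-\frac{s_ky_k^T}{s_k^Ty_k},\qquad H_{k+1}=V_kH_kV_k^T+\frac{s_ks_k^T}{s_k^Ty_k}$$ satisfy, for all $k=0,1,2,\dots$, $$H_k\nabla f(x_k)\in-\mathbb{R}_+s_k,\qquad f(x_{k+1})\le f(x_k)+\mu\nabla f(x_k)^Ts_k,\qquad \nabla f(x_{k+1})^Ts_k\ge\nu\nabla f(x_k)^Ts_k .$$ Assume that the level set $\{x\in U: f(x)\le f(x_0)\}$ is bounded. Assume also that there is an open set $V\subset U$ that contains the closure in $\mathbb{R}^n$ of the set $\{x_k:k\ge 0\}$, satisfies $\inf_V f=\inf_U f>-\infty$, and has the following property: for every $\delta>0$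 there are a convex open set $U_\delta\subset U$ with $\{x\in U: f(x)\le f(x_0)\}\subset U_\delta$ and a $C^{2}$ convex function $f_\delta\colon U_\delta\to\mathbb{R}$ with $f_\delta(x)=f(x)$ for all $x\in U_\delta$ such that $d_{V^c}(x)>\delta$. Here $V^c=\mathbb{R}^n\setminus V$, and $d_{V^c}(x)$ is the Euclidean distance from $x$ to $V^c$, equal to $+\infty$ if $V^c=\emptyset$. Then $f$ attains its minimum over $U$, and $f(x_k)\to\min_U f$ as $k\to\infty$. -/

import Mathlib

open Matrix

/-- The BFGS update of the approximate inverse Hessian `H` for the step `s` and the gradient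
increment `y`: with `V = I - s yᵀ / (sᵀ y)`, it is `V H Vᵀ + s sᵀ / (sᵀ y)`. -/
noncomputable def bfgsUpdate {n : ℕ} (H : Matrix (Fin n) (Fin n) ℝ)
    (s y : EuclideanSpace ℝ (Fin n)) : Matrix (Fin n) (Fin n) ℝ :=
  (1 - (inner ℝ s y)⁻¹ • vecMulVec s.ofLp y.ofLp) * H *
      (1 - (inner ℝ s y)⁻¹ • vecMulVec s.ofLp y.ofLp)ᵀ +
    (inner ℝ s y)⁻¹ • vecMulVec s.ofLp s.ofLp

/-- The matrices `H₀, H₁, H₂, …` generated from `H₀` by the BFGS updates along the points `x k`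
at which the gradients are `g k`. -/
noncomputable def bfgsMatrix {n : ℕ} (H₀ : Matrix (Fin n) (Fin n) ℝ)
    (x g : ℕ → EuclideanSpace ℝ (Fin n)) : ℕ → Matrix (Fin n) (Fin n) ℝ
  | 0 => H₀
  | k + 1 => bfgsUpdate (bfgsMatrix H₀ x g k) (x (k + 1) - x k) (g (k + 1) - g k)

/-- `x` is a BFGS sequence for `f`: `f` is differentiable with nonzero gradient at every iterate,
and for some parameters `0 < μ < ν < 1` and some positive definite `H₀`, each step lies in the
approximate Newton direction and satisfies the Armijo and the weak Wolfe condition.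
Only the behaviour of `f` near the iterates matters, so for a function on an open set `U`
containing the iterates the values of `f` outside `U` are irrelevant. These conditions force
`sₖᵀ yₖ > 0` for all `k`, so no division by zero occurs in the updates. -/
def IsBFGSSequence {n : ℕ} (f : EuclideanSpace ℝ (Fin n) → ℝ)
    (x : ℕ → EuclideanSpace ℝ (Fin n)) : Prop :=
  (∀ k, DifferentiableAt ℝ f (x k) ∧ gradient f (x k) ≠ 0) ∧
  ∃ (μ ν : ℝ) (H₀ : Matrix (Fin n) (Fin n) ℝ),
    0 < μ ∧ μ < ν ∧ ν < 1 ∧ H₀.PosDef ∧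
    ∀ k,
      (∃ t : ℝ, 0 ≤ t ∧
        bfgsMatrix H₀ x (fun j => gradient f (x j)) k *ᵥ (gradient f (x k)).ofLp
          = -(t • (x (k + 1) - x k).ofLp)) ∧
      f (x (k + 1)) ≤ f (x k) + μ * inner ℝ (gradient f (x k)) (x (k + 1) - x k) ∧
      ν * inner ℝ (gradient f (x k)) (x (k + 1) - x k)
        ≤ inner ℝ (gradient f (x (k + 1))) (x (k + 1) - x k)

/-!
Let `gₖ` be the gradient at `xₖ`, let `Bₖ = Hₖ⁻¹` and `ψ(B) = tr B - log det B`, which is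
nonnegative on positive definite matrices. For a convex `C²` function whose Hessians along the
segments between iterates are bounded by `L`, one has `‖yₖ‖² ≤ L sₖᵀyₖ`. As `Bₖsₖ` is a multiple
of `gₖ`, the formulas for the trace and the determinant of `Bₖ₊₁` and the Wolfe condition then give
`ψ(Bₖ₊₁) ≤ ψ(Bₖ) + L - 1 - log((1 - ν) ‖gₖ‖² / (-gₖᵀsₖ))`. The Armijo condition forces
`gₖᵀsₖ → 0`, so if the gradients stayed away from zero, `ψ(Bₖ)` would tend to `-∞`. Hence the
gradient vanishes at some point of the compact closure of the iterates. By convexity `f` is minimal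
there, and the monotone sequence `f(xₖ)` converges to this minimum.
The function `f` is assumed smooth only near the iterates and not on the segments between them, but
the estimate of `‖yₖ‖²` involves `f` only through its gradients at the iterates, so it may be
derived from a smooth convex function that agrees with `f` near the iterates.
-/

section RankTwoUpdate

theorem det_one_add_vecMulVec_add_vecMulVec {ι R : Type*} [Fintype ι] [DecidableEq ι] [CommRing R]
    (u v a b : ι → R) :
    (1 + vecMulVec u v + vecMulVec a b).det =
      (1 + v ⬝ᵥ u) * (1 + b ⬝ᵥ a) - (v ⬝ᵥ a) * (b ⬝ᵥ u) := by
  have hmul : vecMulVec u v + vecMulVec a b = (of ![u, a])ᵀ * of ![v, b] := by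
    ext i j
    simp [mul_apply, vecMulVec_apply]
  rw [add_assoc, hmul, det_one_add_mul_comm, det_fin_two]
  simp [vecMul_transpose, dotProduct_comm]

variable {ι 𝕜 : Type*} [Fintype ι] [Field 𝕜] {B H : Matrix ι ι 𝕜} {s y : ι → 𝕜}

/-- The BFGS update of an approximate Hessian `B` for the step `s` and the gradient increment `y`.
It is the inverse of the update `bfgsUpdate` of `B⁻¹`. -/
def bfgsHessianUpdate (B : Matrix ι ι 𝕜) (s y : ι → 𝕜) : Matrix ι ι 𝕜 :=
  B - (s ⬝ᵥ B *ᵥ s)⁻¹ • vecMulVec (B *ᵥ s) (B *ᵥ s) + (s ⬝ᵥ y)⁻¹ • vecMulVec y y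

theorem trace_bfgsHessianUpdate :
    (bfgsHessianUpdate B s y).trace =
      B.trace - (B *ᵥ s ⬝ᵥ B *ᵥ s) / (s ⬝ᵥ B *ᵥ s) + (y ⬝ᵥ y) / (s ⬝ᵥ y) := by
  simp [bfgsHessianUpdate, trace_add, trace_sub, trace_smul, trace_vecMulVec, div_eq_inv_mul]

theorem vecMul_eq_mulVec_of_isSymm (hB : B.IsSymm) (s : ι → 𝕜) : s ᵥ* B = B *ᵥ s := by
  rw [← mulVec_transpose, hB]

theorem vecMul_bfgsHessianUpdate (hB : B.IsSymm) (hs : s ⬝ᵥ B *ᵥ s ≠ 0) (hsy : s ⬝ᵥ y ≠ 0) :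
    s ᵥ* bfgsHessianUpdate B s y = y := by
  simp [bfgsHessianUpdate, vecMul_add, vecMul_sub, vecMul_smul, vecMul_vecMulVec, smul_smul,
    vecMul_eq_mulVec_of_isSymm hB, hs, hsy]

variable [DecidableEq ι]

theorem transpose_one_sub_smul_vecMulVec_mul_bfgsHessianUpdate (hB : B.IsSymm)
    (hs : s ⬝ᵥ B *ᵥ s ≠ 0) (hsy : s ⬝ᵥ y ≠ 0) :
    (1 - (s ⬝ᵥ y)⁻¹ • vecMulVec s y)ᵀ * bfgsHessianUpdate B s y =
      B - (s ⬝ᵥ B *ᵥ s)⁻¹ • vecMulVec (B *ᵥ s) (B *ᵥ s) := by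
  rw [transpose_sub, transpose_smul, transpose_vecMulVec, transpose_one, sub_mul, one_mul,
    smul_mul, vecMulVec_mul, vecMul_bfgsHessianUpdate hB hs hsy, bfgsHessianUpdate,
    add_sub_cancel_right]

theorem one_sub_smul_vecMulVec_mulVec_self (hsy : s ⬝ᵥ y ≠ 0) :
    (1 - (s ⬝ᵥ y)⁻¹ • vecMulVec s y) *ᵥ s = 0 := by
  rw [sub_mulVec, one_mulVec, smul_mulVec, vecMulVec_mulVec, op_smul_eq_smul, smul_smul,
    dotProduct_comm y, inv_mul_cancel₀ hsy, one_smul, sub_self]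

theorem mul_bfgsHessianUpdate_eq_one (hHB : H * B = 1) (hB : B.IsSymm)
    (hs : s ⬝ᵥ B *ᵥ s ≠ 0) (hsy : s ⬝ᵥ y ≠ 0) :
    ((1 - (s ⬝ᵥ y)⁻¹ • vecMulVec s y) * H * (1 - (s ⬝ᵥ y)⁻¹ • vecMulVec s y)ᵀ +
      (s ⬝ᵥ y)⁻¹ • vecMulVec s s) * bfgsHessianUpdate B s y = 1 := by
  have hHBs : H *ᵥ B *ᵥ s = s := by rw [mulVec_mulVec, hHB, one_mulVec]
  rw [add_mul, mul_assoc, transpose_one_sub_smul_vecMulVec_mul_bfgsHessianUpdate hB hs hsy,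
    mul_assoc, mul_sub H, hHB, Matrix.mul_smul, mul_vecMulVec, hHBs, mul_sub, mul_one,
    Matrix.mul_smul, mul_vecMulVec, one_sub_smul_vecMulVec_mulVec_self hsy, zero_vecMulVec,
    smul_zero, sub_zero, smul_mul, vecMulVec_mul, vecMul_bfgsHessianUpdate hB hs hsy,
    sub_add_cancel]

theorem det_bfgsHessianUpdate (hdet : IsUnit B.det) (hB : B.IsSymm) (hs : s ⬝ᵥ B *ᵥ s ≠ 0)
    (hsy : s ⬝ᵥ y ≠ 0) :
    (bfgsHessianUpdate B s y).det = B.det * ((s ⬝ᵥ y) / (s ⬝ᵥ B *ᵥ s)) := by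
  have hBy : B *ᵥ B⁻¹ *ᵥ y = y := by rw [mulVec_mulVec, mul_nonsing_inv _ hdet, one_mulVec]
  have hsy' : B *ᵥ s ⬝ᵥ B⁻¹ *ᵥ y = s ⬝ᵥ y := by
    rw [← vecMul_eq_mulVec_of_isSymm hB, ← dotProduct_mulVec, hBy]
  have hfactor : bfgsHessianUpdate B s y =
      B * (1 + vecMulVec (-(s ⬝ᵥ B *ᵥ s)⁻¹ • s) (B *ᵥ s) +
        vecMulVec ((s ⬝ᵥ y)⁻¹ • B⁻¹ *ᵥ y) y) := by
    rw [mul_add, mul_add, mul_one, mul_vecMulVec, mul_vecMulVec, mulVec_smul, mulVec_smul, hBy,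
      smul_vecMulVec, smul_vecMulVec, neg_smul, ← sub_eq_add_neg, bfgsHessianUpdate]
  rw [hfactor, det_mul, det_one_add_vecMulVec_add_vecMulVec]
  simp only [dotProduct_smul, smul_eq_mul, hsy', dotProduct_comm (B *ᵥ s) s, dotProduct_comm y s]
  field_simp
  ring

end RankTwoUpdate

section Potential

variable {ι : Type*} [Fintype ι] [DecidableEq ι]

/-- The Byrd–Nocedal potential `tr B - log det B` of an approximate Hessian `B`. A bound on it keeps
the eigenvalues of a positive definite `B` bounded and bounded away from zero. -/
noncomputable def byrdNocedalPotential (B : Matrix ι ι ℝ) : ℝ :=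
  B.trace - Real.log B.det

theorem byrdNocedalPotential_nonneg {B : Matrix ι ι ℝ} (hB : B.PosDef) :
    0 ≤ byrdNocedalPotential B := by
  rw [byrdNocedalPotential, hB.isHermitian.det_eq_prod_eigenvalues,
    hB.isHermitian.trace_eq_sum_eigenvalues, sub_nonneg]
  simp only [RCLike.ofReal_real_eq_id, id_eq]
  rw [Real.log_prod fun i _ => (hB.eigenvalues_pos i).ne']
  exact Finset.sum_le_sum fun i _ => Real.log_le_self (hB.eigenvalues_pos i).le

theorem byrdNocedalPotential_bfgsHessianUpdate_le {B : Matrix ι ι ℝ} {s y : ι → ℝ} (hB : B.PosDef)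
    (hsy : 0 < s ⬝ᵥ y) :
    byrdNocedalPotential (bfgsHessianUpdate B s y) ≤
      byrdNocedalPotential B + (y ⬝ᵥ y) / (s ⬝ᵥ y) - 1 -
        Real.log ((s ⬝ᵥ y) * (B *ᵥ s ⬝ᵥ B *ᵥ s) / (s ⬝ᵥ B *ᵥ s) ^ 2) := by
  have hs : s ≠ 0 := by rintro rfl; simp at hsy
  have hsBs : 0 < s ⬝ᵥ B *ᵥ s := by simpa using hB.dotProduct_mulVec_pos hs
  have hBs : 0 < B *ᵥ s ⬝ᵥ B *ᵥ s :=
    (by simpa using dotProduct_star_self_pos_iff.2 fun h : B *ᵥ s = 0 => by simp [h] at hsBs)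
  have hlog : Real.log ((s ⬝ᵥ y) * (B *ᵥ s ⬝ᵥ B *ᵥ s) / (s ⬝ᵥ B *ᵥ s) ^ 2) =
      Real.log ((s ⬝ᵥ y) / (s ⬝ᵥ B *ᵥ s)) + Real.log ((B *ᵥ s ⬝ᵥ B *ᵥ s) / (s ⬝ᵥ B *ᵥ s)) := by
    rw [← Real.log_mul (by positivity) (by positivity), div_mul_div_comm, sq]
  rw [byrdNocedalPotential, byrdNocedalPotential, trace_bfgsHessianUpdate,
    det_bfgsHessianUpdate hB.det_pos.ne'.isUnit (isHermitian_iff_isSymm.1 hB.isHermitian) hsBs.ne'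
      hsy.ne', Real.log_mul hB.det_pos.ne' (by positivity), hlog]
  linarith [Real.log_le_sub_one_of_pos (div_pos hBs hsBs)]

end Potential

section Convex

variable {E : Type*} [NormedAddCommGroup E] [NormedSpace ℝ E] {U : Set E} {f : E → ℝ}

theorem fderiv_apply_sub_le_of_convexOn (hf : ConvexOn ℝ U f) {p q : E} (hp : p ∈ U) (hq : q ∈ U)
    (hd : DifferentiableAt ℝ f p) : fderiv ℝ f p (q - p) ≤ f q - f p := by
  have hderiv : HasDerivAt (f ∘ AffineMap.lineMap p q) (fderiv ℝ f p (q - p)) (0 : ℝ) :=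
    HasFDerivAt.comp_hasDerivAt 0 (by simpa using hd.hasFDerivAt) AffineMap.hasDerivAt_lineMap
  simpa [slope_def_field] using
    (hf.comp_affineMap (AffineMap.lineMap p q)).le_slope_of_hasDerivAt (by simpa) (by simpa)
      zero_lt_one hderiv

theorem fderiv_fderiv_apply_self_nonneg_of_convexOn (hU : IsOpen U) (hf : ConvexOn ℝ U f)
    (hd : DifferentiableOn ℝ f U) {p : E} (hp : p ∈ U)
    (hd₂ : DifferentiableAt ℝ (fderiv ℝ f) p) (v : E) : 0 ≤ fderiv ℝ (fderiv ℝ f) p v v := by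
  set γ : ℝ →ᵃ[ℝ] E := AffineMap.lineMap p (p + v)
  have hγ (t : ℝ) : HasDerivAt γ v t := by
    simpa using AffineMap.hasDerivAt_lineMap (a := p) (b := p + v) (x := t)
  have hγ0 : γ 0 = p := AffineMap.lineMap_apply_zero _ _
  have hderiv : ∀ t ∈ γ ⁻¹' U, HasDerivAt (f ∘ γ) (fderiv ℝ f (γ t) v) t := fun t ht =>
    ((hd.differentiableAt (hU.mem_nhds ht)).hasFDerivAt).comp_hasDerivAt t (hγ t)
  have hmono : MonotoneOn (fun t => fderiv ℝ f (γ t) v) (γ ⁻¹' U) :=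
    ((hf.comp_affineMap γ).monotoneOn_deriv fun t ht => (hderiv t ht).differentiableAt).congr
      fun t ht => (hderiv t ht).deriv
  have hderiv₂ : HasDerivAt (fun t => fderiv ℝ f (γ t) v) (fderiv ℝ (fderiv ℝ f) p v v) 0 := by
    rw [← hγ0] at hd₂ ⊢
    simpa using (hd₂.hasFDerivAt.comp_hasDerivAt 0 (hγ 0)).clm_apply (hasDerivAt_const 0 v)
  have hopen : IsOpen (γ ⁻¹' U) := hU.preimage (continuous_iff_continuousAt.2 fun t =>
    (hγ t).continuousAt)
  rw [← hderiv₂.deriv, ← derivWithin_of_isOpen hopen (by simpa [hγ0])]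
  exact hmono.derivWithin_nonneg

theorem apply_apply_le_of_opNorm_le {A : E →L[ℝ] E →L[ℝ] ℝ} (hsymm : ∀ u w, A u w = A w u)
    (hnonneg : ∀ v, 0 ≤ A v v) {L : ℝ} (hL : ‖A‖ ≤ L) (u w : E) :
    A u w ≤ (‖w‖ ^ 2 + L * A u u) / 2 := by
  have hww : A w w ≤ L * ‖w‖ ^ 2 := calc
    A w w ≤ ‖A‖ * ‖w‖ * ‖w‖ := (le_abs_self _).trans (A.le_opNorm₂ w w)
    _ = ‖A‖ * ‖w‖ ^ 2 := by ring
    _ ≤ L * ‖w‖ ^ 2 := by gcongr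
  have hcs : A u w ^ 2 ≤ A u u * A w w :=
    LinearMap.BilinForm.apply_sq_le_of_symm (A.toLinearMap₁₂) hnonneg ⟨fun u w => hsymm u w⟩ u w
  have hamgm : (2 * A u w) ^ 2 ≤ (‖w‖ ^ 2 + L * A u u) ^ 2 := by
    nlinarith [mul_le_mul_of_nonneg_left hww (hnonneg u), sq_nonneg (‖w‖ ^ 2 - L * A u u)]
  have hsum : 0 ≤ ‖w‖ ^ 2 + L * A u u :=
    add_nonneg (sq_nonneg _) (mul_nonneg ((norm_nonneg A).trans hL) (hnonneg u))
  linarith [le_of_sq_le_sq hamgm hsum]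

theorem exists_forall_segment_norm_le {F : Type*} [SeminormedAddCommGroup F] {K : Set E} {G : E → F}
    (hU : Convex ℝ U) (hG : ContinuousOn G U) (hK : IsCompact K) (hKU : K ⊆ U) :
    ∃ M, ∀ p ∈ K, ∀ q ∈ K, ∀ z ∈ segment ℝ p q, ‖G z‖ ≤ M := by
  have hline : ContinuousOn (fun a : (E × E) × ℝ => G (AffineMap.lineMap a.1.1 a.1.2 a.2))
      ((K ×ˢ K) ×ˢ Set.Icc 0 1) :=
    hG.comp (by simp only [AffineMap.lineMap_apply_module]; fun_prop) fun a ha =>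
      hU.lineMap_mem (hKU ha.1.1) (hKU ha.1.2) ha.2
  obtain ⟨M, hM⟩ := ((hK.prod hK).prod isCompact_Icc).exists_bound_of_continuousOn hline
  refine ⟨M, fun p hp q hq z hz => ?_⟩
  rw [segment_eq_image_lineMap] at hz
  obtain ⟨t, ht, rfl⟩ := hz
  exact hM ((p, q), t) ⟨⟨hp, hq⟩, ht⟩

theorem fderiv_sub_apply_le_of_segment (hU : IsOpen U) (hf : ConvexOn ℝ U f)
    (hC : ContDiffOn ℝ 2 f U) {p q : E} (hp : p ∈ U) (hq : q ∈ U) {L : ℝ}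
    (hL : ∀ z ∈ segment ℝ p q, ‖fderiv ℝ (fderiv ℝ f) z‖ ≤ L) (w : E) :
    (fderiv ℝ f q - fderiv ℝ f p) w ≤
      (‖w‖ ^ 2 + L * (fderiv ℝ f q - fderiv ℝ f p) (q - p)) / 2 := by
  have hd₂ : ∀ z ∈ U, DifferentiableAt ℝ (fderiv ℝ f) z := fun z hz =>
    ((hC.fderiv_of_isOpen hU (m := 1) le_rfl).differentiableOn one_ne_zero).differentiableAt
      (hU.mem_nhds hz)
  -- The mean value theorem is applied along this direction because the bound below is an estimate
  -- of `φ w - L / 2 * φ (q - p)` for the functional `φ = fderiv ℝ (fderiv ℝ f) z (q - p)`.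
  set v := (L / 2) • (q - p) - w
  obtain ⟨z, hz, hmvt⟩ : ∃ z ∈ segment ℝ p q,
      (fderiv ℝ f q - fderiv ℝ f p) v = fderiv ℝ (fderiv ℝ f) z (q - p) v :=
    domain_mvt (f := fun z => fderiv ℝ f z v) (f' := fun z => (fderiv ℝ (fderiv ℝ f) z).flip v)
      (fun z hz => by
        simpa using ((hd₂ z hz).hasFDerivAt.clm_apply (hasFDerivAt_const v z)).hasFDerivWithinAt)
      hf.1 hp hq
  have hzU : z ∈ U := hf.1.segment_subset hp hq hz
  have hbound := apply_apply_le_of_opNorm_le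
    ((hC.contDiffAt (hU.mem_nhds hzU)).isSymmSndFDerivAt (by simp)).eq
    (fderiv_fderiv_apply_self_nonneg_of_convexOn hU hf (hC.differentiableOn two_ne_zero) hzU
      (hd₂ z hzU)) (hL z hz) (q - p) w
  have hv (φ : E →L[ℝ] ℝ) : φ v = L / 2 * φ (q - p) - φ w := by simp [v]
  rw [hv, hv] at hmvt
  linarith

end Convex

section Gradient

variable {E : Type*} [NormedAddCommGroup E] [InnerProductSpace ℝ E] [CompleteSpace E]
  {U K : Set E} {f : E → ℝ}

theorem isMinOn_of_convexOn_of_gradient_eq_zero (hf : ConvexOn ℝ U f) {z : E} (hz : z ∈ U)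
    (hd : DifferentiableAt ℝ f z) (hgrad : gradient f z = 0) : IsMinOn f U z := fun w hw => by
  have htangent := fderiv_apply_sub_le_of_convexOn hf hz hw hd
  rw [← inner_gradient_left, hgrad, inner_zero_left] at htangent
  exact sub_nonneg.1 htangent

theorem exists_norm_sq_gradient_sub_le_of_convexOn (hU : IsOpen U) (hf : ConvexOn ℝ U f)
    (hC : ContDiffOn ℝ 2 f U) (hK : IsCompact K) (hKU : K ⊆ U) :
    ∃ L : ℝ, ∀ p ∈ K, ∀ q ∈ K,
      ‖gradient f q - gradient f p‖ ^ 2 ≤ L * inner ℝ (q - p) (gradient f q - gradient f p) := by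
  obtain ⟨L, hL⟩ := exists_forall_segment_norm_le hf.1
    ((hC.fderiv_of_isOpen hU le_rfl).continuousOn_fderiv_of_isOpen hU le_rfl) hK hKU
  refine ⟨L, fun p hp q hq => ?_⟩
  have hinner (w : E) :
      (fderiv ℝ f q - fderiv ℝ f p) w = inner ℝ w (gradient f q - gradient f p) := by
    rw [inner_sub_right, inner_gradient_right, inner_gradient_right]
    rfl
  have hbound := fderiv_sub_apply_le_of_segment hU hf hC (hKU hp) (hKU hq) (hL p hp q hq)
    (gradient f q - gradient f p)
  rw [hinner, hinner, real_inner_self_eq_norm_sq] at hbound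
  linarith

end Gradient

section Model

variable {E : Type*} [NormedAddCommGroup E]

section NormedSpace

variable [NormedSpace ℝ E] {f : E → ℝ} {K : Set E}

/-- On a neighbourhood of `K` the function `f` coincides with a convex `C²` function `h`. The domain
`W` of `h` is convex (this is part of `ConvexOn`), hence it contains the segments between points of
`K`, along which `f` itself need not be smooth. -/
def HasConvexC2ModelNear (f : E → ℝ) (K : Set E) : Prop :=
  ∃ (W : Set E) (h : E → ℝ), IsOpen W ∧ K ⊆ W ∧ ContDiffOn ℝ 2 h W ∧ ConvexOn ℝ W h ∧
    h =ᶠ[nhdsSet K] f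

namespace HasConvexC2ModelNear

theorem differentiableAt (hf : HasConvexC2ModelNear f K) {z : E} (hz : z ∈ K) :
    DifferentiableAt ℝ f z := by
  obtain ⟨W, h, hW, hKW, hC, -, hfh⟩ := hf
  have hd := (hC.differentiableOn two_ne_zero).differentiableAt (hW.mem_nhds (hKW hz))
  exact hd.congr_of_eventuallyEq (hfh.filter_mono (nhds_le_nhdsSet hz)).symm

theorem continuousOn (hf : HasConvexC2ModelNear f K) : ContinuousOn f K := fun _ hz =>
  (hf.differentiableAt hz).continuousAt.continuousWithinAt

end HasConvexC2ModelNear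

theorem exists_forall_lt_infEDist_compl {X : Type*} [PseudoEMetricSpace X] {K V : Set X}
    (hK : IsCompact K) (hV : IsOpen V) (hKV : K ⊆ V) :
    ∃ δ : ℝ, 0 < δ ∧ ∀ z ∈ K, ENNReal.ofReal δ < Metric.infEDist z Vᶜ := by
  obtain ⟨r, hr, hdist⟩ := Metric.exists_pos_forall_lt_edist hK hV.isClosed_compl
    (Set.disjoint_compl_right_iff_subset.2 hKV)
  refine ⟨r / 2, by positivity, fun z hz => ?_⟩
  calc ENNReal.ofReal (r / 2) < ENNReal.ofReal r :=
        (ENNReal.ofReal_lt_ofReal_iff (by positivity)).2 (half_lt_self (by positivity))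
    _ = r := ENNReal.ofReal_coe_nnreal
    _ ≤ Metric.infEDist z Vᶜ := Metric.le_infEDist.2 fun w hw => (hdist z hz w hw).le

theorem hasConvexC2ModelNear_of_forall_infEDist {V : Set E} (hK : IsCompact K) (hV : IsOpen V)
    (hKV : K ⊆ V)
    (happrox : ∀ δ : ℝ, 0 < δ → ∃ (W : Set E) (h : E → ℝ), IsOpen W ∧ K ⊆ W ∧
      ContDiffOn ℝ 2 h W ∧ ConvexOn ℝ W h ∧
      ∀ z ∈ W, ENNReal.ofReal δ < Metric.infEDist z Vᶜ → h z = f z) :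
    HasConvexC2ModelNear f K := by
  obtain ⟨δ, hδ, hδK⟩ := exists_forall_lt_infEDist_compl hK hV hKV
  obtain ⟨W, h, hW, hKW, hC, hh, hfh⟩ := happrox δ hδ
  refine ⟨W, h, hW, hKW, hC, hh, eventually_nhdsSet_iff_forall.2 fun z hz => ?_⟩
  filter_upwards [hW.mem_nhds (hKW hz),
    Metric.continuous_infEDist.continuousAt.eventually_const_lt (hδK z hz)] with w hw hδw
  exact hfh w hw hδw

end NormedSpace

section InnerProductSpace

variable [InnerProductSpace ℝ E] [CompleteSpace E] {f : E → ℝ} {K : Set E}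

namespace HasConvexC2ModelNear

theorem continuousOn_gradient (hf : HasConvexC2ModelNear f K) : ContinuousOn (gradient f) K := by
  obtain ⟨W, h, hW, hKW, hC, -, hfh⟩ := hf
  have hcont : ContinuousOn (gradient h) W :=
    (InnerProductSpace.toDual ℝ E).symm.continuous.comp_continuousOn
      (hC.continuousOn_fderiv_of_isOpen hW one_le_two)
  exact (hcont.mono hKW).congr fun z hz =>
    (hfh.filter_mono (nhds_le_nhdsSet hz)).symm.gradient_eq

theorem exists_norm_sq_gradient_sub_le (hf : HasConvexC2ModelNear f K) (hK : IsCompact K) :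
    ∃ L : ℝ, ∀ p ∈ K, ∀ q ∈ K,
      ‖gradient f q - gradient f p‖ ^ 2 ≤ L * inner ℝ (q - p) (gradient f q - gradient f p) := by
  obtain ⟨W, h, hW, hKW, hC, hh, hfh⟩ := hf
  obtain ⟨L, hL⟩ := exists_norm_sq_gradient_sub_le_of_convexOn hW hh hC hK hKW
  have hgrad : ∀ z ∈ K, gradient h z = gradient f z := fun z hz =>
    (hfh.filter_mono (nhds_le_nhdsSet hz)).gradient_eq
  exact ⟨L, fun p hp q hq => by simpa only [hgrad p hp, hgrad q hq] using hL p hp q hq⟩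

end HasConvexC2ModelNear

end InnerProductSpace

end Model

section Sequences

theorem exists_eq_zero_of_forall_exists_norm_lt {X F : Type*} [TopologicalSpace X]
    [NormedAddCommGroup F] {K : Set X} (hK : IsCompact K) {G : X → F} (hG : ContinuousOn G K)
    (hsmall : ∀ ε > 0, ∃ z ∈ K, ‖G z‖ < ε) : ∃ z ∈ K, G z = 0 := by
  obtain ⟨z₀, hz₀, -⟩ := hsmall 1 one_pos
  obtain ⟨z, hz, hmin⟩ := hK.exists_isMinOn ⟨z₀, hz₀⟩ hG.norm
  refine ⟨z, hz, by_contra fun hne => ?_⟩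
  obtain ⟨w, hw, hlt⟩ := hsmall ‖G z‖ (norm_pos_iff.2 hne)
  exact hlt.not_ge (hmin hw)

theorem tendsto_of_antitone_of_mem_closure_range {X ι α : Type*} [TopologicalSpace X] [Preorder ι]
    [LinearOrder α] [TopologicalSpace α] [OrderTopology α] {f : X → α} {x : ι → X} {z : X}
    (hanti : Antitone fun k => f (x k)) (hz : z ∈ closure (Set.range x)) (hf : ContinuousAt f z)
    (hle : ∀ k, f z ≤ f (x k)) : Filter.Tendsto (fun k => f (x k)) Filter.atTop (nhds (f z)) := by
  refine tendsto_atTop_isGLB hanti ⟨Set.forall_mem_range.2 hle, fun b hb => ?_⟩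
  by_contra! hlt
  obtain ⟨_, hw, k, rfl⟩ := mem_closure_iff_nhds.1 hz _ (hf.eventually_lt_const hlt)
  exact (hb ⟨k, rfl⟩).not_gt hw

theorem not_tendsto_atTop_of_le_add_sub {ψ r : ℕ → ℝ} {C : ℝ} (hψ : ∀ k, 0 ≤ ψ k)
    (hstep : ∀ k, ψ (k + 1) ≤ ψ k + C - r k) : ¬ Filter.Tendsto r Filter.atTop Filter.atTop := by
  intro hr
  obtain ⟨N, hN⟩ := Filter.eventually_atTop.1 (hr.eventually_ge_atTop (C + 1))
  have hdecrease (j : ℕ) : ψ (N + j) ≤ ψ N - j := by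
    induction j with
    | zero => simp
    | succ j ih =>
      rw [← add_assoc]
      push_cast
      linarith [hstep (N + j), hN (N + j) (Nat.le_add_right N j)]
  obtain ⟨j, hj⟩ := exists_nat_gt (ψ N)
  linarith [hdecrease j, hψ (N + j)]

end Sequences

section BFGS

variable {n : ℕ} {H : Matrix (Fin n) (Fin n) ℝ} {s y g : EuclideanSpace ℝ (Fin n)}

theorem real_inner_eq_dotProduct {ι : Type*} [Fintype ι] (s y : EuclideanSpace ℝ ι) :
    inner ℝ s y = s.ofLp ⬝ᵥ y.ofLp := by
  rw [EuclideanSpace.inner_eq_star_dotProduct, star_trivial, dotProduct_comm]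

theorem bfgsUpdate_mul_bfgsHessianUpdate_inv (hH : H.PosDef) (hsy : 0 < inner ℝ s y) :
    bfgsUpdate H s y * bfgsHessianUpdate H⁻¹ s.ofLp y.ofLp = 1 := by
  rw [real_inner_eq_dotProduct] at hsy
  have hs : s.ofLp ≠ 0 := fun h => by simp [h] at hsy
  rw [bfgsUpdate, real_inner_eq_dotProduct]
  exact mul_bfgsHessianUpdate_eq_one (mul_nonsing_inv _ hH.det_pos.ne'.isUnit)
    (isHermitian_iff_isSymm.1 hH.inv.isHermitian)
    (by simpa using (hH.inv.dotProduct_mulVec_pos hs).ne') hsy.ne'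

theorem posDef_bfgsUpdate (hH : H.PosDef) (hsy : 0 < inner ℝ s y) : (bfgsUpdate H s y).PosDef := by
  have hVHV := hH.posSemidef.mul_mul_conjTranspose_same
    (1 - (inner ℝ s y)⁻¹ • vecMulVec s.ofLp y.ofLp)
  have hss := (posSemidef_vecMulVec_self_star s.ofLp).smul (inv_nonneg.2 hsy.le)
  rw [conjTranspose_eq_transpose_of_trivial] at hVHV
  rw [star_trivial] at hss
  have hsemidef : (bfgsUpdate H s y).PosSemidef := hVHV.add hss
  exact hsemidef.posDef_iff_isUnit.2
    (IsUnit.of_mul_eq_one _ (bfgsUpdate_mul_bfgsHessianUpdate_inv hH hsy))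

theorem pos_and_inner_neg_of_mulVec_eq {t : ℝ} (hH : H.PosDef) (hg : g ≠ 0) (ht : 0 ≤ t)
    (hs : H *ᵥ g.ofLp = -(t • s.ofLp)) : 0 < t ∧ inner ℝ g s < 0 := by
  have hgHg : 0 < t * -inner ℝ g s := by
    have hpos := hH.dotProduct_mulVec_pos (x := g.ofLp) (by simpa using hg)
    rw [star_trivial, hs, dotProduct_neg, dotProduct_smul, smul_eq_mul,
      ← real_inner_eq_dotProduct] at hpos
    linarith
  have ht' : 0 < t := ht.lt_of_ne (by rintro rfl; simp at hgHg)
  exact ⟨ht', neg_pos.1 (pos_of_mul_pos_right hgHg ht)⟩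

theorem byrdNocedalPotential_inv_bfgsUpdate_le {t c L : ℝ} (hH : H.PosDef) (hg : g ≠ 0)
    (ht : 0 ≤ t) (hs : H *ᵥ g.ofLp = -(t • s.ofLp)) (hc : 0 < c)
    (hsy : c * -inner ℝ g s ≤ inner ℝ s y) (hy : ‖y‖ ^ 2 ≤ L * inner ℝ s y) :
    byrdNocedalPotential (bfgsUpdate H s y)⁻¹ ≤
      byrdNocedalPotential H⁻¹ + (L - 1) - Real.log (c * (‖g‖ ^ 2 / -inner ℝ g s)) := by
  obtain ⟨ht', hgs⟩ := pos_and_inner_neg_of_mulVec_eq hH hg ht hs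
  have hgs' : 0 < -inner ℝ g s := neg_pos.2 hgs
  have hsy' : 0 < inner ℝ s y := (mul_pos hc hgs').trans_le hsy
  have hBs : H⁻¹ *ᵥ s.ofLp = -t⁻¹ • g.ofLp := by
    have hg' : g.ofLp = -t • H⁻¹ *ᵥ s.ofLp := by
      rw [neg_smul, ← mulVec_smul, ← mulVec_neg, ← hs, mulVec_mulVec,
        nonsing_inv_mul _ hH.det_pos.ne'.isUnit, one_mulVec]
    rw [hg', smul_smul, neg_mul_neg, inv_mul_cancel₀ ht'.ne', one_smul]
  have hratio : inner ℝ s y * (H⁻¹ *ᵥ s.ofLp ⬝ᵥ H⁻¹ *ᵥ s.ofLp) /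
      (s.ofLp ⬝ᵥ H⁻¹ *ᵥ s.ofLp) ^ 2 = inner ℝ s y * ‖g‖ ^ 2 / inner ℝ g s ^ 2 := by
    rw [hBs, smul_dotProduct, dotProduct_smul, dotProduct_smul, ← real_inner_eq_dotProduct,
      ← real_inner_eq_dotProduct, real_inner_self_eq_norm_sq, real_inner_comm g s]
    simp only [smul_eq_mul]
    field_simp
  have hlog : Real.log (c * (‖g‖ ^ 2 / -inner ℝ g s)) ≤
      Real.log (inner ℝ s y * ‖g‖ ^ 2 / inner ℝ g s ^ 2) := by
    refine Real.log_le_log (by positivity) ?_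
    calc c * (‖g‖ ^ 2 / -inner ℝ g s)
        = c * -inner ℝ g s * ‖g‖ ^ 2 / inner ℝ g s ^ 2 := by field_simp
      _ ≤ inner ℝ s y * ‖g‖ ^ 2 / inner ℝ g s ^ 2 := by gcongr
  have hupdate := byrdNocedalPotential_bfgsHessianUpdate_le (y := y.ofLp) hH.inv
    ((real_inner_eq_dotProduct s y).symm ▸ hsy')
  rw [← real_inner_eq_dotProduct, ← real_inner_eq_dotProduct, real_inner_self_eq_norm_sq,
    hratio] at hupdate
  rw [inv_eq_right_inv (bfgsUpdate_mul_bfgsHessianUpdate_inv hH hsy')]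
  linarith [(div_le_iff₀ hsy').2 hy]

end BFGS

section Run

variable {n : ℕ} {ν : ℝ} {H₀ : Matrix (Fin n) (Fin n) ℝ} {x g : ℕ → EuclideanSpace ℝ (Fin n)}

/-- The part of the definition of a BFGS sequence that involves the objective function only through
its gradients `g k` at the points `x k`: the quasi-Newton direction of the steps and the weak Wolfe
condition. -/
structure IsBFGSRun (ν : ℝ) (H₀ : Matrix (Fin n) (Fin n) ℝ) (x g : ℕ → EuclideanSpace ℝ (Fin n)) :
    Prop where
  lt_one : ν < 1
  posDef : H₀.PosDef
  ne_zero : ∀ k, g k ≠ 0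
  newton : ∀ k, ∃ t : ℝ, 0 ≤ t ∧
    bfgsMatrix H₀ x g k *ᵥ (g k).ofLp = -(t • (x (k + 1) - x k).ofLp)
  wolfe : ∀ k, ν * inner ℝ (g k) (x (k + 1) - x k) ≤ inner ℝ (g (k + 1)) (x (k + 1) - x k)

namespace IsBFGSRun

theorem le_inner (h : IsBFGSRun ν H₀ x g) (k : ℕ) :
    (1 - ν) * -inner ℝ (g k) (x (k + 1) - x k) ≤ inner ℝ (x (k + 1) - x k) (g (k + 1) - g k) := by
  rw [real_inner_comm (g (k + 1) - g k), inner_sub_left]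
  linarith [h.wolfe k]

theorem inner_neg_of_posDef (h : IsBFGSRun ν H₀ x g) {k : ℕ}
    (hk : (bfgsMatrix H₀ x g k).PosDef) : inner ℝ (g k) (x (k + 1) - x k) < 0 := by
  obtain ⟨t, ht, hs⟩ := h.newton k
  exact (pos_and_inner_neg_of_mulVec_eq hk (h.ne_zero k) ht hs).2

theorem posDef_bfgsMatrix (h : IsBFGSRun ν H₀ x g) : ∀ k, (bfgsMatrix H₀ x g k).PosDef
  | 0 => h.posDef
  | k + 1 => posDef_bfgsUpdate (h.posDef_bfgsMatrix k) <|
      (mul_pos (sub_pos.2 h.lt_one)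
        (neg_pos.2 (h.inner_neg_of_posDef (h.posDef_bfgsMatrix k)))).trans_le (h.le_inner k)

theorem inner_neg (h : IsBFGSRun ν H₀ x g) (k : ℕ) : inner ℝ (g k) (x (k + 1) - x k) < 0 :=
  h.inner_neg_of_posDef (h.posDef_bfgsMatrix k)

theorem byrdNocedalPotential_succ_le (h : IsBFGSRun ν H₀ x g) {L : ℝ} {k : ℕ}
    (hL : ‖g (k + 1) - g k‖ ^ 2 ≤ L * inner ℝ (x (k + 1) - x k) (g (k + 1) - g k)) :
    byrdNocedalPotential (bfgsMatrix H₀ x g (k + 1))⁻¹ ≤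
      byrdNocedalPotential (bfgsMatrix H₀ x g k)⁻¹ + (L - 1) -
        Real.log ((1 - ν) * (‖g k‖ ^ 2 / -inner ℝ (g k) (x (k + 1) - x k))) := by
  obtain ⟨t, ht, hs⟩ := h.newton k
  exact byrdNocedalPotential_inv_bfgsUpdate_le (h.posDef_bfgsMatrix k) (h.ne_zero k) ht hs
    (sub_pos.2 h.lt_one) (h.le_inner k) hL

theorem exists_norm_lt (h : IsBFGSRun ν H₀ x g) {L : ℝ}
    (hL : ∀ k, ‖g (k + 1) - g k‖ ^ 2 ≤ L * inner ℝ (x (k + 1) - x k) (g (k + 1) - g k))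
    (hlim : Filter.Tendsto (fun k => inner ℝ (g k) (x (k + 1) - x k)) Filter.atTop (nhds 0))
    {ε : ℝ} (hε : 0 < ε) : ∃ k, ‖g k‖ < ε := by
  by_contra! hlarge
  refine not_tendsto_atTop_of_le_add_sub
    (fun k => byrdNocedalPotential_nonneg (h.posDef_bfgsMatrix k).inv)
    (fun k => h.byrdNocedalPotential_succ_le (hL k)) (Real.tendsto_log_atTop.comp ?_)
  have hlim' : Filter.Tendsto (fun k => -inner ℝ (g k) (x (k + 1) - x k)) Filter.atTop
      (nhdsWithin 0 (Set.Ioi 0)) :=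
    tendsto_nhdsWithin_iff.2 ⟨by simpa using hlim.neg,
      .of_forall fun k => neg_pos.2 (h.inner_neg k)⟩
  refine Filter.Tendsto.const_mul_atTop (sub_pos.2 h.lt_one) ?_
  refine Filter.tendsto_atTop_mono (fun k => ?_)
    (hlim'.inv_tendsto_nhdsGT_zero.const_mul_atTop (pow_pos hε 2))
  have hneg := neg_pos.2 (h.inner_neg k)
  rw [Pi.inv_apply, ← div_eq_mul_inv]
  gcongr
  exact hlarge k

end IsBFGSRun

end Run

section Convergence

variable {n : ℕ} {f : EuclideanSpace ℝ (Fin n) → ℝ} {x : ℕ → EuclideanSpace ℝ (Fin n)}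
  {U : Set (EuclideanSpace ℝ (Fin n))}

namespace IsBFGSSequence

theorem exists_isBFGSRun (hx : IsBFGSSequence f x) :
    ∃ (μ ν : ℝ) (H₀ : Matrix (Fin n) (Fin n) ℝ), 0 < μ ∧
      IsBFGSRun ν H₀ x (fun k => gradient f (x k)) ∧
      ∀ k, f (x (k + 1)) ≤ f (x k) + μ * inner ℝ (gradient f (x k)) (x (k + 1) - x k) := by
  obtain ⟨hgrad, μ, ν, H₀, hμ, -, hν, hH₀, hstep⟩ := hx
  exact ⟨μ, ν, H₀, hμ, ⟨hν, hH₀, fun k => (hgrad k).2, fun k => (hstep k).1,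
    fun k => (hstep k).2.2⟩, fun k => (hstep k).2.1⟩

theorem antitone (hx : IsBFGSSequence f x) : Antitone fun k => f (x k) := by
  obtain ⟨μ, ν, H₀, hμ, hrun, harmijo⟩ := hx.exists_isBFGSRun
  exact antitone_nat_of_succ_le fun k => (harmijo k).trans <|
    add_le_of_nonpos_right (mul_nonpos_of_nonneg_of_nonpos hμ.le (hrun.inner_neg k).le)

theorem tendsto_inner_gradient (hx : IsBFGSSequence f x)
    (hbdd : BddBelow (Set.range fun k => f (x k))) :
    Filter.Tendsto (fun k => inner ℝ (gradient f (x k)) (x (k + 1) - x k)) Filter.atTop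
      (nhds 0) := by
  obtain ⟨μ, ν, H₀, hμ, hrun, harmijo⟩ := hx.exists_isBFGSRun
  have hlim := tendsto_atTop_ciInf hx.antitone hbdd
  have hdecrease : Filter.Tendsto (fun k => (f (x (k + 1)) - f (x k)) / μ) Filter.atTop
      (nhds 0) := by
    simpa using ((hlim.comp (Filter.tendsto_add_atTop_nat 1)).sub hlim).div_const μ
  refine tendsto_of_tendsto_of_tendsto_of_le_of_le hdecrease tendsto_const_nhds (fun k => ?_)
    fun k => (hrun.inner_neg k).le
  rw [div_le_iff₀' hμ]
  linarith [harmijo k]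

theorem exists_norm_gradient_lt (hx : IsBFGSSequence f x)
    (hbdd : BddBelow (Set.range fun k => f (x k))) {L : ℝ}
    (hL : ∀ k, ‖gradient f (x (k + 1)) - gradient f (x k)‖ ^ 2 ≤
      L * inner ℝ (x (k + 1) - x k) (gradient f (x (k + 1)) - gradient f (x k)))
    {ε : ℝ} (hε : 0 < ε) : ∃ k, ‖gradient f (x k)‖ < ε := by
  obtain ⟨_, _, _, _, hrun, -⟩ := hx.exists_isBFGSRun
  exact hrun.exists_norm_lt hL (hx.tendsto_inner_gradient hbdd) hε

theorem closure_range_subset_sublevel (hx : IsBFGSSequence f x)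
    (hxU : closure (Set.range x) ⊆ U) (hf : ContinuousOn f U) :
    closure (Set.range x) ⊆ {z | z ∈ U ∧ f z ≤ f (x 0)} := fun _ hz =>
  ⟨hxU hz, ((hf _ (hxU hz)).mono (subset_closure.trans hxU)).closure_le hz
    continuousWithinAt_const (Set.forall_mem_range.2 fun k => hx.antitone k.zero_le)⟩

end IsBFGSSequence

theorem theorem4_general (hf : ConvexOn ℝ U f) (hx : IsBFGSSequence f x)
    (hxU : closure (Set.range x) ⊆ U) (hbdd : Bornology.IsBounded (Set.range x))
    (hmodel : HasConvexC2ModelNear f (closure (Set.range x))) :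
    ∃ m, IsLeast (f '' U) m ∧ Filter.Tendsto (fun k => f (x k)) Filter.atTop (nhds m) := by
  have hK : IsCompact (closure (Set.range x)) := hbdd.isCompact_closure
  have hxK (k : ℕ) : x k ∈ closure (Set.range x) := subset_closure ⟨k, rfl⟩
  have hbelow : BddBelow (Set.range fun k => f (x k)) :=
    (hK.bddBelow_image hmodel.continuousOn).mono
      (Set.range_subset_iff.2 fun k => Set.mem_image_of_mem f (hxK k))
  obtain ⟨L, hL⟩ := hmodel.exists_norm_sq_gradient_sub_le hK
  have hsmall : ∀ ε > 0, ∃ z ∈ closure (Set.range x), ‖gradient f z‖ < ε := fun ε hε => by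
    obtain ⟨k, hk⟩ :=
      hx.exists_norm_gradient_lt hbelow (fun k => hL _ (hxK k) _ (hxK (k + 1))) hε
    exact ⟨x k, hxK k, hk⟩
  obtain ⟨z, hzK, hz⟩ :=
    exists_eq_zero_of_forall_exists_norm_lt hK hmodel.continuousOn_gradient hsmall
  have hdz := hmodel.differentiableAt hzK
  have hmin : IsMinOn f U z := isMinOn_of_convexOn_of_gradient_eq_zero hf (hxU hzK) hdz hz
  exact ⟨f z, ⟨⟨z, hxU hzK, rfl⟩, Set.forall_mem_image.2 hmin⟩,
    tendsto_of_antitone_of_mem_closure_range hx.antitone hzK hdz.continuousAt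
      fun k => hmin (hxU (hxK k))⟩

end Convergence

theorem theorem4 {n : ℕ} (U : Set (EuclideanSpace ℝ (Fin n))) (hU : IsOpen U)
    (f : EuclideanSpace ℝ (Fin n) → ℝ) (hf : ConvexOn ℝ U f)
    (x : ℕ → EuclideanSpace ℝ (Fin n)) (hxU : ∀ k, x k ∈ U) (hx : IsBFGSSequence f x)
    (hbdd : Bornology.IsBounded {z | z ∈ U ∧ f z ≤ f (x 0)})
    (V : Set (EuclideanSpace ℝ (Fin n))) (hV : IsOpen V) (hVU : V ⊆ U)
    (hxV : closure (Set.range x) ⊆ V)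
    (m : ℝ) (hm : IsGLB (f '' U) m) (hmV : IsGLB (f '' V) m)
    (happrox : ∀ δ : ℝ, 0 < δ →
      ∃ (Uδ : Set (EuclideanSpace ℝ (Fin n))) (fδ : EuclideanSpace ℝ (Fin n) → ℝ),
        IsOpen Uδ ∧ Convex ℝ Uδ ∧ Uδ ⊆ U ∧ {z | z ∈ U ∧ f z ≤ f (x 0)} ⊆ Uδ ∧
        ContDiffOn ℝ 2 fδ Uδ ∧ ConvexOn ℝ Uδ fδ ∧
        ∀ z ∈ Uδ, ENNReal.ofReal δ < Metric.infEDist z Vᶜ → fδ z = f z) :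
    IsLeast (f '' U) m ∧
      Filter.Tendsto (fun k => f (x k)) Filter.atTop (nhds m) := by
  have hxU := hxV.trans hVU
  have hsub := hx.closure_range_subset_sublevel hxU (hf.continuousOn hU)
  have hbddx : Bornology.IsBounded (Set.range x) := hbdd.subset (subset_closure.trans hsub)
  have hmodel : HasConvexC2ModelNear f (closure (Set.range x)) :=
    hasConvexC2ModelNear_of_forall_infEDist hbddx.isCompact_closure hV hxV fun δ hδ =>
      let ⟨W, h, hW, _, _, hlevel, hC, hh, heq⟩ := happrox δ hδ
      ⟨W, h, hW, hsub.trans hlevel, hC, hh, heq⟩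
  obtain ⟨m', hm', hlim⟩ := theorem4_general hf hx hxU hbddx hmodel
  exact hm'.isGLB.unique hm ▸ ⟨hm', hlim⟩
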